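/- Let $C, A_1,\dots,A_m \in \mathbb{R}^{n\times n}$ ($n \ge 1$) be symmetric, $\mathbf{b}\in\mathbb{R}^m$ and $\beta>0$. Write $\lambda\cdot\mathbf{A} = \sum_i \lambda_i A_i$, let $S(X)=\mathrm{Tr}[X\log X]$ be the von Neumann entropy, and let $f_\beta$ be the negative of the dual function of the entropically regularized semidefinite program "minimize $\mathrm{Tr}[CX]+\beta^{-1}S(X)$ subject to $\mathrm{Tr}[A_iX]=b_i$, $\mathrm{Tr}[X]=1$, $X\succeq 0$": $$ f_\beta(\lambda) = -\min_{X\succeq 0,\ \mathrm{Tr}[X]=1} \Big\{ \mathrm{Tr}[CX]+\beta^{-1}S(X) - \sum_{i=1}^m \lambda_i\big(\mathrm{Tr}[A_iX]-b_i\big)\Big\}, \qquad \lambda\in\mathbb{R}^m. $$ Let $\|\cdot\|$ be a norm on $\mathbb{R}^m$ such that $\|\lambda\cdot\mathbf{A}\|_2\le\|\lambda\|$ for all $\lambda$, where $\|\cdot\|_2$ is the spectral norm, and let $\|\cdot\|_*$ be its dual norm. Let $0<\eta\le 1/(2\beta)$, $\gamma\ge 0$ and $T\in\mathbb{N}\cup\{\infty\}$,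 and let iterates $\lambda_t\in\mathbb{R}^m$ ($0\le t\le T$, $t<\infty$) and gradient estimates $g_t\in\mathbb{R}^m$ ($0\le t<T$) satisfy, for all $0\le t<T$, $$ \lambda_{t+1}\in\operatorname*{argmin}_{\lambda\in\mathbb{R}^m}\Big\{ f_\beta(\lambda_t)+g_t\cdot(\lambda-\lambda_t)+\frac{1}{2\eta}\|\lambda-\lambda_t\|^2\Big\}, \qquad \|g_t-\nabla f_\beta(\lambda_t)\|_*\le\gamma. $$ Let $\lambda_\star$ be a minimizer of $f_\beta$, and assume that $D := \sup_{t}\|\lambda_t-\lambda_\star\|^2$ (the supremum over all iterates) is finite and that $\gamma\le\sqrt{3\beta^2D/2}$. Then for every iterate with $t\ge 1$, $$ f_\beta(\lambda_t)-f_\beta(\lambda_\star)\le\bigg(1-\frac{2\gamma}{\sqrt{2(\eta^{-1}-\beta)(2\eta^{-1}-\beta)D}}\bigg)^{t}\big[f_\beta(\lambda_0)-f_\beta(\lambda_\star)\big]+\frac{\gamma\sqrt{2(2\eta^{-1}-\beta)D}}{\sqrt{\eta^{-1}-\beta}}. $$ In particular, if $\eta=1/(2\beta)$, then for every iterate with $t\ge1$,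 $$ f_\beta(\lambda_t)-f_\beta(\lambda_\star)\le\bigg(1-\frac{2\gamma}{\sqrt{6\beta^2D}}\bigg)^{t}\big[f_\beta(\lambda_0)-f_\beta(\lambda_\star)\big]+\gamma\sqrt{6D}. $$ (If $D=0$, then $\gamma=0$ and the quotients $0/0$ are read as $0$.) -/

import Mathlib

namespace EntropicSDP

noncomputable section

/-- The set `𝒫₁` of density operators: positive semidefinite (in particular symmetric) real
`n × n` matrices of trace one. -/
def densityMatrices (n : ℕ) : Set (Matrix (Fin n) (Fin n) ℝ) :=
  {X | X.PosSemidef ∧ X.trace = 1}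

/-- The von Neumann entropy `S(X) = Tr[X log X]` of a positive semidefinite matrix, where `log X`
is given by the functional calculus (`0 log 0 = 0`). -/
def entropy {n : ℕ} (X : Matrix (Fin n) (Fin n) ℝ) : ℝ :=
  (X * cfc Real.log X).trace

/-- The matrix `x · 𝐀 = ∑ i, x i • A i`. -/
def comb {m n : ℕ} (A : Fin m → Matrix (Fin n) (Fin n) ℝ) (x : EuclideanSpace ℝ (Fin m)) :
    Matrix (Fin n) (Fin n) ℝ :=
  ∑ i, x i • A i

/-- The spectral norm `‖M‖₂`, i.e. the operator norm with respect to the Euclidean norm. -/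
def specNorm {n : ℕ} (M : Matrix (Fin n) (Fin n) ℝ) : ℝ :=
  ‖Matrix.toEuclideanCLM (n := Fin n) (𝕜 := ℝ) M‖

/-- The Lagrangian `Tr[C X] + β⁻¹ S(X) - x · (Tr[𝐀 X] - b)` of the entropically regularized
semidefinite program, in which only the constraints `Tr[A i X] = b i` are dualized. -/
def lagrangian {m n : ℕ} (C : Matrix (Fin n) (Fin n) ℝ) (A : Fin m → Matrix (Fin n) (Fin n) ℝ)
    (b : EuclideanSpace ℝ (Fin m)) (β : ℝ) (X : Matrix (Fin n) (Fin n) ℝ)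
    (x : EuclideanSpace ℝ (Fin m)) : ℝ :=
  (C * X).trace + β⁻¹ * entropy X - ∑ i, x i * ((A i * X).trace - b i)

/-- The dual function: the minimum of the Lagrangian over the density operators. -/
def dualFun {m n : ℕ} (C : Matrix (Fin n) (Fin n) ℝ) (A : Fin m → Matrix (Fin n) (Fin n) ℝ)
    (b : EuclideanSpace ℝ (Fin m)) (β : ℝ) (x : EuclideanSpace ℝ (Fin m)) : ℝ :=
  sInf ((fun X => lagrangian C A b β X x) '' densityMatrices n)

/-- The objective `f_β`, the negative of the dual function, which is to be minimized. -/
def objective {m n : ℕ} (C : Matrix (Fin n) (Fin n) ℝ) (A : Fin m → Matrix (Fin n) (Fin n) ℝ)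
    (b : EuclideanSpace ℝ (Fin m)) (β : ℝ) (x : EuclideanSpace ℝ (Fin m)) : ℝ :=
  -dualFun C A b β x

/-- The dual norm `‖g‖_* = sup {g · y | ‖y‖ ≤ 1}` of a norm `N` on `ℝᵐ`. -/
def dualNorm {m : ℕ} (N : Seminorm ℝ (EuclideanSpace ℝ (Fin m)))
    (g : EuclideanSpace ℝ (Fin m)) : ℝ :=
  sSup ((fun y => inner ℝ g y) '' {y | N y ≤ 1})

/-- `x'` is a result of one step of steepest descent for `f` from `x` with respect to the norm `N`,
with gradient estimate `g` and step size `η`: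
`x' ∈ argmin_y {f(x) + g · (y - x) + (1 / (2 η)) ‖y - x‖²}`. -/
def IsDescentStep {m : ℕ} (N : Seminorm ℝ (EuclideanSpace ℝ (Fin m)))
    (f : EuclideanSpace ℝ (Fin m) → ℝ) (η : ℝ) (g x x' : EuclideanSpace ℝ (Fin m)) : Prop :=
  IsMinOn (fun y => f x + inner ℝ g (y - x) + 1 / (2 * η) * N (y - x) ^ 2) Set.univ x'

end

end EntropicSDP

/-! Two analytic facts about `f_β` carry the theorem. By the Gibbs variational principle the inner
minimum is attained at a Gibbs state, so that `f_β(x) = β⁻¹ log Tr exp(β (x·𝐀 - C)) - b·x`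
(`objective_eq`). Using the Gibbs state at `x` as a competitor at `y` gives the convexity inequality
`objective_add_inner_le`. The matching upper bound, `β`-smoothness with respect to `N`
(`objective_le_add_inner`), comes from Golden–Thompson, which decouples the perturbation, followed
by Hoeffding's lemma for its spectral distribution in the Gibbs state.

For the descent, compare the model minimizer with the point `x + α (λ⋆ - x)`. The step size leaves a
negative quadratic term, which absorbs the gradient error along the step. The suboptimality `δ_t`
then satisfies `δ_{t+1} ≤ (1 - α) δ_t + α ε`, where `ε` is the final accuracy, and this recursion
unrolls to the claim. -/

open Filter Topology

/-! ### The Lie–Trotter product formula -/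

section LieTrotter

variable {𝔸 : Type*} [NormedRing 𝔸] [NormOneClass 𝔸]

/-- Telescoping bound; `1 ≤ M` allows the exponent `k` in place of `k - 1`. -/
theorem norm_pow_sub_pow_le_mul {x y : 𝔸} {M : ℝ} (hM : 1 ≤ M) (hx : ‖x‖ ≤ M) (hy : ‖y‖ ≤ M)
    (k : ℕ) : ‖x ^ k - y ^ k‖ ≤ k * M ^ k * ‖x - y‖ := by
  induction k with
  | zero => simp
  | succ k ih =>
    have h1 : x ^ (k + 1) - y ^ (k + 1) = x ^ k * (x - y) + (x ^ k - y ^ k) * y := by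
      rw [pow_succ, pow_succ]; noncomm_ring
    have h2 : ‖x ^ k‖ ≤ M ^ k := (norm_pow_le x k).trans (by gcongr)
    have h3 : M ^ k ≤ M ^ (k + 1) := pow_le_pow_right₀ hM (Nat.le_succ k)
    calc ‖x ^ (k + 1) - y ^ (k + 1)‖
        ≤ ‖x ^ k‖ * ‖x - y‖ + ‖x ^ k - y ^ k‖ * ‖y‖ := by
          rw [h1]
          exact (norm_add_le _ _).trans (add_le_add (norm_mul_le _ _) (norm_mul_le _ _))
      _ ≤ M ^ (k + 1) * ‖x - y‖ + (k * M ^ k * ‖x - y‖) * M := by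
          have : ‖x ^ k‖ ≤ M ^ (k + 1) := h2.trans h3
          gcongr
      _ = ((k + 1 : ℕ) : ℝ) * M ^ (k + 1) * ‖x - y‖ := by push_cast; ring

variable [NormedAlgebra ℝ 𝔸]

theorem NormedSpace.norm_exp_le_exp_norm (x : 𝔸) : ‖NormedSpace.exp x‖ ≤ Real.exp ‖x‖ := by
  rw [NormedSpace.exp_eq_tsum ℝ]
  refine tsum_of_norm_bounded (g := fun k : ℕ => ‖x‖ ^ k / k.factorial) ?_ fun k => ?_
  · rw [Real.exp_eq_exp_ℝ]
    exact NormedSpace.expSeries_div_hasSum_exp ‖x‖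
  · rw [norm_smul, norm_inv, Real.norm_natCast, div_eq_inv_mul]
    gcongr
    exact norm_pow_le x k

/-- The **Lie–Trotter product formula**. -/
theorem tendsto_exp_mul_exp_pow [CompleteSpace 𝔸] (a b : 𝔸) :
    Tendsto (fun k : ℕ => (NormedSpace.exp ((k : ℝ)⁻¹ • a) * NormedSpace.exp ((k : ℝ)⁻¹ • b)) ^ k)
      atTop (𝓝 (NormedSpace.exp (a + b))) := by
  let : NormedAlgebra ℚ 𝔸 := .restrictScalars ℚ ℝ 𝔸
  -- `F` and its derivative vanish at `0`, so `k F(1/k) → 0`, which beats the factor `k` lost in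
  -- telescoping.
  set F : ℝ → 𝔸 := fun t => NormedSpace.exp (t • a) * NormedSpace.exp (t • b)
    - NormedSpace.exp (t • (a + b)) with hF
  have hder : HasDerivAt F 0 0 := by
    have := ((hasDerivAt_exp_smul_const (𝕂 := ℝ) a 0).mul
      (hasDerivAt_exp_smul_const (𝕂 := ℝ) b 0)).sub (hasDerivAt_exp_smul_const (𝕂 := ℝ) (a + b) 0)
    exact this.congr_deriv (by simp [smul_add])
  have hF0 : F 0 = 0 := by simp [hF]
  have hinv : Tendsto (fun k : ℕ => (k : ℝ)⁻¹) atTop (𝓝[>] 0) :=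
    tendsto_inv_atTop_nhdsGT_zero.comp tendsto_natCast_atTop_atTop
  have hlim : Tendsto (fun k : ℕ => (k : ℝ) • F (k : ℝ)⁻¹) atTop (𝓝 0) := by
    have := hder.tendsto_slope_zero_right.comp hinv
    simpa [Function.comp_def, hF0] using this
  have hbound : Tendsto (fun k : ℕ => Real.exp (‖a‖ + ‖b‖) * ‖(k : ℝ) • F (k : ℝ)⁻¹‖) atTop
      (𝓝 0) := by
    simpa using hlim.norm.const_mul (Real.exp (‖a‖ + ‖b‖))
  rw [tendsto_iff_norm_sub_tendsto_zero]
  refine squeeze_zero' (Eventually.of_forall fun _ => norm_nonneg _) ?_ hbound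
  filter_upwards [eventually_gt_atTop 0] with k hk
  have hk' : (0 : ℝ) < k := by exact_mod_cast hk
  set s : ℝ := (k : ℝ)⁻¹ with hs
  have hs0 : 0 < s := inv_pos.2 hk'
  have hexp : NormedSpace.exp (s • (a + b)) ^ k = NormedSpace.exp (a + b) := by
    rw [← NormedSpace.exp_nsmul, ← Nat.cast_smul_eq_nsmul ℝ, smul_smul, hs,
      mul_inv_cancel₀ hk'.ne', one_smul]
  have hpow : Real.exp (s * (‖a‖ + ‖b‖)) ^ k = Real.exp (‖a‖ + ‖b‖) := by
    rw [← Real.exp_nat_mul, ← mul_assoc, hs, mul_inv_cancel₀ hk'.ne', one_mul]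
  have hnorm : ∀ x : 𝔸, ‖s • x‖ = s * ‖x‖ := fun x => by
    rw [norm_smul, Real.norm_of_nonneg hs0.le]
  -- This `M` has `k`-th power `exp (‖a‖ + ‖b‖)`, independent of `k`.
  have h := norm_pow_sub_pow_le_mul (x := NormedSpace.exp (s • a) * NormedSpace.exp (s • b))
    (y := NormedSpace.exp (s • (a + b))) (M := Real.exp (s * (‖a‖ + ‖b‖)))
    (Real.one_le_exp (by positivity)) ?_ ?_ k
  · rw [hexp, hpow] at h
    refine h.trans_eq ?_
    rw [norm_smul, Real.norm_natCast, hF]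
    ring
  · refine (norm_mul_le _ _).trans ?_
    rw [mul_add, Real.exp_add, ← hnorm, ← hnorm]
    gcongr <;> exact NormedSpace.norm_exp_le_exp_norm _
  · refine (NormedSpace.norm_exp_le_exp_norm _).trans (Real.exp_le_exp.2 ?_)
    rw [hnorm]
    gcongr
    exact norm_add_le _ _

end LieTrotter

/-! ### Trace inequalities and Golden–Thompson -/

namespace Matrix

variable {ι : Type*} [Fintype ι]

theorem trace_mul_sq_le (A B : Matrix ι ι ℝ) :
    (A * B).trace ^ 2 ≤ (A * Aᵀ).trace * (B * Bᵀ).trace := by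
  have h1 : (A * B).trace = ∑ p : ι × ι, A p.1 p.2 * B p.2 p.1 := by
    simp [trace, mul_apply, Fintype.sum_prod_type]
  have h2 : (A * Aᵀ).trace = ∑ p : ι × ι, A p.1 p.2 ^ 2 := by
    simp [trace, mul_apply, Fintype.sum_prod_type, sq]
  have h3 : (B * Bᵀ).trace = ∑ p : ι × ι, B p.2 p.1 ^ 2 := by
    simp only [trace, diag_apply, mul_apply, transpose_apply, Fintype.sum_prod_type, sq]
    exact Finset.sum_comm
  rw [h1, h2, h3]
  exact Finset.sum_mul_sq_le_sq_mul_sq _ _ _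

variable [DecidableEq ι]

theorem trace_mul_pow_comm (A B : Matrix ι ι ℝ) (k : ℕ) :
    ((A * B) ^ k).trace = ((B * A) ^ k).trace := by
  cases k with
  | zero => simp
  | succ k =>
    have h : ∀ j : ℕ, (A * B) ^ j * A = A * (B * A) ^ j := fun j => by
      induction j with
      | zero => simp
      | succ j ih => rw [pow_succ', mul_assoc, ih, pow_succ']; simp only [mul_assoc]
    rw [pow_succ, ← mul_assoc, h, trace_mul_comm, pow_succ', mul_assoc]

/-- Cauchy–Schwarz iterated by squaring: the induction hypothesis is used for the pair `A B`, `A B`,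
then, after cyclic rearrangement, for `Aᵀ A`, `B Bᵀ`. -/
theorem trace_mul_pow_two_pow_sq_le (k : ℕ) (A B : Matrix ι ι ℝ) :
    ((A * B) ^ 2 ^ k).trace ^ 2 ≤ ((A * Aᵀ) ^ 2 ^ k).trace * ((B * Bᵀ) ^ 2 ^ k).trace := by
  induction k generalizing A B with
  | zero => simpa using trace_mul_sq_le A B
  | succ k ih =>
    have hsq : ∀ M : Matrix ι ι ℝ, M ^ 2 ^ (k + 1) = (M * M) ^ 2 ^ k := fun M => by
      rw [pow_succ, mul_comm (2 ^ k), pow_mul, sq]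
    have h1 := ih (A * B) (A * B)
    rw [← hsq, ← sq] at h1
    have h2 : ((A * B * (A * B)ᵀ) ^ 2 ^ k).trace = ((Aᵀ * A * (B * Bᵀ)) ^ 2 ^ k).trace := by
      rw [transpose_mul, mul_assoc A B, trace_mul_pow_comm A]
      rw [show B * (Bᵀ * Aᵀ) * A = B * Bᵀ * (Aᵀ * A) by simp only [mul_assoc], trace_mul_pow_comm]
    have h3 := ih (Aᵀ * A) (B * Bᵀ)
    have h4 : ((Aᵀ * A) ^ 2 ^ (k + 1)).trace = ((A * Aᵀ) ^ 2 ^ (k + 1)).trace :=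
      trace_mul_pow_comm _ _ _
    simp only [transpose_mul, transpose_transpose, ← hsq] at h3
    rw [h4] at h3
    rw [h2] at h1
    exact h1.trans h3

/-- For symmetric `X` and `Y`, `Tr (X Y)^(2^k) ≤ Tr X^(2^k) Y^(2^k)`. -/
theorem trace_mul_pow_two_pow_le (k : ℕ) {X Y : Matrix ι ι ℝ} (hX : X.IsSymm) (hY : Y.IsSymm) :
    ((X * Y) ^ 2 ^ k).trace ≤ (X ^ 2 ^ k * Y ^ 2 ^ k).trace := by
  induction k generalizing X Y with
  | zero => simp
  | succ k ih =>
    have hsq : ∀ M : Matrix ι ι ℝ, M ^ 2 ^ (k + 1) = (M * M) ^ 2 ^ k := fun M => by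
      rw [pow_succ, mul_comm (2 ^ k), pow_mul, sq]
    have hX2 : (X * X).IsSymm := by rw [IsSymm, transpose_mul, hX.eq]
    have hY2 : (Y * Y).IsSymm := by rw [IsSymm, transpose_mul, hY.eq]
    have h1 := trace_mul_pow_two_pow_sq_le k (X * Y) (X * Y)
    have h2 : ((X * Y * (X * Y)ᵀ) ^ 2 ^ k).trace = ((X * X * (Y * Y)) ^ 2 ^ k).trace := by
      rw [transpose_mul, hX.eq, hY.eq, mul_assoc X Y, trace_mul_pow_comm X]
      rw [show Y * (Y * X) * X = Y * Y * (X * X) by simp only [mul_assoc], trace_mul_pow_comm]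
    have h3 : 0 ≤ ((X * Y * (X * Y)ᵀ) ^ 2 ^ k).trace := by
      have : (X * Y * (X * Y)ᵀ).PosSemidef := by
        simpa using posSemidef_self_mul_conjTranspose (X * Y)
      exact (this.pow _).trace_nonneg
    rw [← hsq, ← sq] at h1
    have h4 := abs_le_of_sq_le_sq h1 h3
    rw [h2] at h4
    have := ih hX2 hY2
    rw [← hsq, ← hsq] at this
    exact (le_abs_self _).trans (h4.trans this)

open scoped Norms.Operator in
theorem tendsto_exp_mul_exp_pow [Nonempty ι] (H K : Matrix ι ι ℝ) :
    Tendsto (fun k : ℕ => (NormedSpace.exp ((k : ℝ)⁻¹ • H) * NormedSpace.exp ((k : ℝ)⁻¹ • K)) ^ k)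
      atTop (𝓝 (NormedSpace.exp (H + K))) :=
  _root_.tendsto_exp_mul_exp_pow H K

/-- The **Golden–Thompson inequality** for real symmetric matrices. -/
theorem trace_exp_add_le [Nonempty ι] {H K : Matrix ι ι ℝ} (hH : H.IsSymm) (hK : K.IsSymm) :
    (NormedSpace.exp (H + K)).trace ≤ (NormedSpace.exp H * NormedSpace.exp K).trace := by
  have htr : Continuous (trace : Matrix ι ι ℝ → ℝ) := by fun_prop
  -- Only the subsequence `2 ^ k` is used, since the trace inequality holds for those exponents.
  have h := (htr.tendsto _).comp ((tendsto_exp_mul_exp_pow H K).comp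
    (tendsto_pow_atTop_atTop_of_one_lt (α := ℕ) one_lt_two))
  refine le_of_tendsto h (Eventually.of_forall fun k => ?_)
  have hexp : ∀ M : Matrix ι ι ℝ,
      NormedSpace.exp (((2 ^ k : ℕ) : ℝ)⁻¹ • M) ^ 2 ^ k = NormedSpace.exp M := fun M => by
    rw [← Matrix.exp_nsmul, ← Nat.cast_smul_eq_nsmul ℝ, smul_smul, mul_inv_cancel₀ (by positivity),
      one_smul]
  have := trace_mul_pow_two_pow_le k (X := NormedSpace.exp (((2 ^ k : ℕ) : ℝ)⁻¹ • H))
    (Y := NormedSpace.exp (((2 ^ k : ℕ) : ℝ)⁻¹ • K)) (hH.smul _).exp (hK.smul _).exp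
  rwa [hexp, hexp] at this

end Matrix

/-! ### Scalar inequalities of Hoeffding and Gibbs -/

/-- **Hoeffding's lemma** for a finitely supported distribution. -/
theorem sum_mul_exp_le_exp_of_abs_le {ι : Type*} [Fintype ι] {w κ : ι → ℝ} {c : ℝ}
    (hw : ∀ i, 0 ≤ w i) (hw1 : ∑ i, w i = 1) (hκ : ∀ i, |κ i| ≤ c) :
    ∑ i, w i * Real.exp (κ i) ≤ Real.exp (∑ i, w i * κ i + c ^ 2 / 2) := by
  let : MeasurableSpace ι := ⊤
  have : MeasurableSingletonClass ι := ⟨fun _ => trivial⟩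
  let p : PMF ι := PMF.ofFintype (fun i => ENNReal.ofReal (w i)) (by
    rw [← ENNReal.ofReal_sum_of_nonneg fun i _ => hw i, hw1, ENNReal.ofReal_one])
  have hint : ∀ F : ι → ℝ, ∫ i, F i ∂p.toMeasure = ∑ i, w i * F i := fun F => by
    rw [PMF.integral_eq_sum]
    simp [p, ENNReal.toReal_ofReal (hw _)]
  have hsub := ProbabilityTheory.hasSubgaussianMGF_of_mem_Icc (μ := p.toMeasure) (X := κ)
    (a := -c) (b := c) (measurable_of_finite κ).aemeasurable
    (Eventually.of_forall fun i => abs_le.1 (hκ i))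
  have hmgf := hsub.mgf_le 1
  simp only [ProbabilityTheory.mgf, hint, one_mul] at hmgf
  have hc : (((‖c - -c‖₊ / 2) ^ 2 : NNReal) : ℝ) * 1 ^ 2 / 2 = c ^ 2 / 2 := by
    push_cast
    rw [Real.norm_eq_abs, div_pow, sq_abs]
    ring
  rw [hc] at hmgf
  rw [Real.exp_add, ← div_le_iff₀' (Real.exp_pos _), Finset.sum_div]
  simpa only [Real.exp_sub, mul_div_assoc] using hmgf

/-- **Gibbs' inequality** for a finitely supported distribution. -/
theorem sum_mul_sub_mul_log_le {ι : Type*} [Fintype ι] {p h : ι → ℝ} {Z : ℝ}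
    (hp : ∀ i, 0 ≤ p i) (hp1 : ∑ i, p i = 1) (hZ0 : 0 < Z) (hZ : ∑ i, Real.exp (h i) ≤ Z) :
    ∑ i, p i * h i - ∑ i, p i * Real.log (p i) ≤ Real.log Z := by
  -- Termwise `log u ≤ u - 1` at `u = exp (h i) / (p i * Z)`; zero weights are treated apart.
  have key : ∀ i, p i * h i - p i * Real.log (p i) - p i * Real.log Z ≤ Real.exp (h i) / Z - p i := by
    intro i
    rcases (hp i).eq_or_lt with h0 | h0
    · rw [← h0]
      simpa using (by positivity : 0 ≤ Real.exp (h i) / Z)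
    · have := Real.log_le_sub_one_of_pos (x := Real.exp (h i) / (p i * Z)) (by positivity)
      rw [Real.log_div (Real.exp_pos _).ne' (by positivity), Real.log_exp,
        Real.log_mul h0.ne' hZ0.ne'] at this
      calc _ = p i * (h i - (Real.log (p i) + Real.log Z)) := by ring
        _ ≤ p i * (Real.exp (h i) / (p i * Z) - 1) := by gcongr
        _ = _ := by field_simp
  have hsum := Finset.sum_le_sum fun i (_ : i ∈ Finset.univ) => key i
  simp only [Finset.sum_sub_distrib, ← Finset.sum_mul, ← Finset.sum_div, hp1] at hsum
  have : (∑ i, Real.exp (h i)) / Z ≤ 1 := (div_le_one hZ0).2 hZ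
  linarith

/-! ### Spectral weights and Peierls' inequality -/

namespace Matrix

variable {ι : Type*} [Fintype ι] [DecidableEq ι]

namespace IsHermitian

variable {H : Matrix ι ι ℝ}

/-- The diagonal entries of `X` in the eigenbasis of `H`. -/
noncomputable def eigenWeight (hH : H.IsHermitian) (X : Matrix ι ι ℝ) (j : ι) : ℝ :=
  (star (hH.eigenvectorUnitary : Matrix ι ι ℝ) * X * (hH.eigenvectorUnitary : Matrix ι ι ℝ)) j j

theorem cfc_eq_mul_diagonal_mul (hH : H.IsHermitian) (f : ℝ → ℝ) :
    cfc f H = (hH.eigenvectorUnitary : Matrix ι ι ℝ) * diagonal (fun j => f (hH.eigenvalues j)) *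
      star (hH.eigenvectorUnitary : Matrix ι ι ℝ) := by
  rw [hH.cfc_eq, IsHermitian.cfc, Unitary.conjStarAlgAut_apply]
  rfl

/-- For a density matrix `X` the weights form a probability distribution, so traces become
expectations and scalar inequalities apply. -/
theorem trace_mul_cfc (hH : H.IsHermitian) (f : ℝ → ℝ) (X : Matrix ι ι ℝ) :
    (X * cfc f H).trace = ∑ j, hH.eigenWeight X j * f (hH.eigenvalues j) := by
  rw [hH.cfc_eq_mul_diagonal_mul, ← mul_assoc, trace_mul_comm, ← mul_assoc, ← mul_assoc]
  simp [trace, eigenWeight]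

theorem trace_mul_eq_sum_eigenWeight (hH : H.IsHermitian) (X : Matrix ι ι ℝ) :
    (X * H).trace = ∑ j, hH.eigenWeight X j * hH.eigenvalues j := by
  conv_lhs => rw [← cfc_id ℝ H hH.isSelfAdjoint, hH.trace_mul_cfc]
  rfl

theorem sum_eigenWeight (hH : H.IsHermitian) (X : Matrix ι ι ℝ) : ∑ j, hH.eigenWeight X j = X.trace := by
  change (star (hH.eigenvectorUnitary : Matrix ι ι ℝ) * X * _).trace = _
  rw [trace_mul_comm, ← mul_assoc, Unitary.mul_star_self_of_mem hH.eigenvectorUnitary.2, one_mul]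

theorem eigenWeight_nonneg (hH : H.IsHermitian) {X : Matrix ι ι ℝ} (hX : X.PosSemidef) (j : ι) :
    0 ≤ hH.eigenWeight X j :=
  (hX.conjTranspose_mul_mul_same (hH.eigenvectorUnitary : Matrix ι ι ℝ)).diag_nonneg

theorem eigenWeight_self (hH : H.IsHermitian) (j : ι) : hH.eigenWeight H j = hH.eigenvalues j := by
  have h := hH.conjStarAlgAut_star_eigenvectorUnitary
  rw [Unitary.conjStarAlgAut_apply] at h
  have := congrFun (congrFun h j) j
  simpa [eigenWeight] using this

theorem trace_cfc (hH : H.IsHermitian) (f : ℝ → ℝ) : (cfc f H).trace = ∑ j, f (hH.eigenvalues j) := by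
  rw [hH.cfc_eq_mul_diagonal_mul, trace_mul_comm, ← mul_assoc,
    Unitary.star_mul_self_of_mem hH.eigenvectorUnitary.2, one_mul, trace_diagonal]

theorem trace_cfc_exp_pos (hH : H.IsHermitian) [Nonempty ι] : 0 < (cfc Real.exp H).trace := by
  rw [hH.trace_cfc]
  exact Finset.sum_pos (fun _ _ => Real.exp_pos _) Finset.univ_nonempty

theorem posSemidef_cfc_exp (hH : H.IsHermitian) : (cfc Real.exp H).PosSemidef := by
  rw [hH.cfc_eq_mul_diagonal_mul]
  exact (PosSemidef.diagonal fun _ => (Real.exp_pos _).le).mul_mul_conjTranspose_same _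

theorem normedSpace_exp_eq_cfc (hH : H.IsHermitian) : NormedSpace.exp H = cfc Real.exp H := by
  have hU : IsUnit (hH.eigenvectorUnitary : Matrix ι ι ℝ) :=
    (Unitary.toUnits hH.eigenvectorUnitary).isUnit
  have hinv : (hH.eigenvectorUnitary : Matrix ι ι ℝ)⁻¹ = star (hH.eigenvectorUnitary : Matrix ι ι ℝ) :=
    inv_eq_right_inv (Unitary.mul_star_self_of_mem hH.eigenvectorUnitary.2)
  conv_lhs => rw [← cfc_id ℝ H hH.isSelfAdjoint, hH.cfc_eq_mul_diagonal_mul, ← hinv, exp_conj _ _ hU, exp_diagonal]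
  rw [hH.cfc_eq_mul_diagonal_mul, hinv]
  congr 3
  ext j
  simp [Real.exp_eq_exp_ℝ, Pi.coe_exp]

/-- Peierls' inequality for a density matrix. -/
theorem exp_trace_mul_le (hH : H.IsHermitian) {E : Matrix ι ι ℝ} (hE : E.PosSemidef) (hE1 : E.trace = 1) :
    Real.exp (E * H).trace ≤ (E * cfc Real.exp H).trace := by
  rw [hH.trace_mul_cfc, hH.trace_mul_eq_sum_eigenWeight]
  simpa using convexOn_exp.map_sum_le (t := Finset.univ) (w := hH.eigenWeight E)
    (p := hH.eigenvalues) (fun j _ => hH.eigenWeight_nonneg hE j)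
    (by rw [hH.sum_eigenWeight, hE1]) (fun _ _ => Set.mem_univ _)

/-- Peierls' inequality in an eigenbasis. -/
theorem exp_eigenWeight_le (hH : H.IsHermitian) {X : Matrix ι ι ℝ} (hX : X.IsHermitian) (i : ι) :
    Real.exp (hX.eigenWeight H i) ≤ hX.eigenWeight (cfc Real.exp H) i := by
  set U := (hX.eigenvectorUnitary : Matrix ι ι ℝ)
  -- The rank-one projection onto the `i`-th eigenvector of `X`.
  set E : Matrix ι ι ℝ := U * diagonal (Pi.single i 1) * star U
  have hE : E.PosSemidef :=
    (PosSemidef.diagonal (by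
      intro j
      by_cases h : j = i
      · subst h; simp
      · simp [h])).mul_mul_conjTranspose_same _
  have htr : ∀ M : Matrix ι ι ℝ, (E * M).trace = hX.eigenWeight M i := fun M => by
    rw [trace_mul_comm, ← mul_assoc, ← mul_assoc, trace_mul_comm, ← mul_assoc, ← mul_assoc]
    simp [trace, eigenWeight, U, Pi.single_apply]
  have hE1 : E.trace = 1 := by
    rw [trace_mul_comm, ← mul_assoc, Unitary.star_mul_self_of_mem hX.eigenvectorUnitary.2, one_mul]
    simp
  simpa only [htr] using hH.exp_trace_mul_le hE hE1

end IsHermitian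

end Matrix

/-! ### Gibbs states and the log-partition function -/

namespace EntropicSDP

variable {n : ℕ}

/-- The logarithm of the partition function `Tr exp H`. -/
noncomputable def logPartition (H : Matrix (Fin n) (Fin n) ℝ) : ℝ :=
  Real.log (cfc Real.exp H).trace

/-- The Gibbs state `exp H / Tr exp H`. -/
noncomputable def gibbs (H : Matrix (Fin n) (Fin n) ℝ) : Matrix (Fin n) (Fin n) ℝ :=
  (cfc Real.exp H).trace⁻¹ • cfc Real.exp H

/-- In the eigenbasis of `X` this is the scalar Gibbs inequality; Peierls bounds the scalar
partition sum by `Tr exp H`. -/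
theorem trace_mul_sub_entropy_le [NeZero n] {H X : Matrix (Fin n) (Fin n) ℝ} (hH : H.IsHermitian)
    (hX : X ∈ densityMatrices n) : (X * H).trace - entropy X ≤ logPartition H := by
  obtain ⟨hX0, hX1⟩ := hX
  have h := sum_mul_sub_mul_log_le (p := hX0.isHermitian.eigenvalues)
    (h := hX0.isHermitian.eigenWeight H) hX0.eigenvalues_nonneg
    (by simp_rw [← hX0.isHermitian.eigenWeight_self]; rw [hX0.isHermitian.sum_eigenWeight, hX1])
    hH.trace_cfc_exp_pos
    ((Finset.sum_le_sum fun i _ => hH.exp_eigenWeight_le hX0.isHermitian i).trans_eq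
      (hX0.isHermitian.sum_eigenWeight _))
  rw [entropy, hX0.isHermitian.trace_mul_cfc, Matrix.trace_mul_comm,
    hX0.isHermitian.trace_mul_eq_sum_eigenWeight]
  simpa only [hX0.isHermitian.eigenWeight_self, mul_comm, logPartition] using h

theorem gibbs_mem [NeZero n] {H : Matrix (Fin n) (Fin n) ℝ} (hH : H.IsHermitian) :
    gibbs H ∈ densityMatrices n := by
  refine ⟨hH.posSemidef_cfc_exp.smul (inv_nonneg.2 hH.trace_cfc_exp_pos.le), ?_⟩
  rw [gibbs, Matrix.trace_smul, smul_eq_mul, inv_mul_cancel₀ hH.trace_cfc_exp_pos.ne']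

theorem trace_gibbs_mul_sub_entropy [NeZero n] {H : Matrix (Fin n) (Fin n) ℝ}
    (hH : H.IsHermitian) : (gibbs H * H).trace - entropy (gibbs H) = logPartition H := by
  have hZ := hH.trace_cfc_exp_pos
  have hfin : ∀ f : ℝ → ℝ, ContinuousOn f (spectrum ℝ H) := fun f =>
    (Matrix.finite_real_spectrum).continuousOn f
  have hg : gibbs H = cfc (fun x => (cfc Real.exp H).trace⁻¹ * Real.exp x) H := by
    rw [gibbs, ← cfc_const_mul _ _ H (hfin _)]
  have hlog : cfc Real.log (gibbs H) = cfc (fun x => x - logPartition H) H := by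
    conv_lhs => rw [hg]
    rw [← cfc_comp' Real.log _ H (((Matrix.finite_real_spectrum).image _).continuousOn _) (hfin _) hH.isSelfAdjoint]
    congr 1
    ext x
    rw [Real.log_mul (inv_ne_zero hZ.ne') (Real.exp_pos x).ne', Real.log_exp, Real.log_inv,
      logPartition]
    ring
  rw [entropy, hlog, hH.trace_mul_cfc, hH.trace_mul_eq_sum_eigenWeight]
  simp only [mul_sub, Finset.sum_sub_distrib, ← Finset.sum_mul, hH.sum_eigenWeight]
  rw [(gibbs_mem hH).2]
  ring

/-- The logarithmic partition function is `1`-smooth with respect to the spectral norm. -/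
theorem logPartition_add_le [NeZero n] {H K : Matrix (Fin n) (Fin n) ℝ} (hH : H.IsHermitian)
    (hK : K.IsHermitian) {c : ℝ} (hc : ∀ j, |hK.eigenvalues j| ≤ c) :
    logPartition (H + K) ≤ logPartition H + (gibbs H * K).trace + c ^ 2 / 2 := by
  have hZ := hH.trace_cfc_exp_pos
  have hGT := Matrix.trace_exp_add_le (H := H) (K := K) (by simpa using hH) (by simpa using hK)
  rw [(hH.add hK).normedSpace_exp_eq_cfc, hH.normedSpace_exp_eq_cfc,
    hK.normedSpace_exp_eq_cfc] at hGT
  have hg : cfc Real.exp H = (cfc Real.exp H).trace • gibbs H := by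
    rw [gibbs, smul_smul, mul_inv_cancel₀ hZ.ne', one_smul]
  have hmem := gibbs_mem hH
  -- The spectral distribution of `K` in the Gibbs state has mean `Tr[ρ K]` and lives in `[-c, c]`.
  have hHoeff := sum_mul_exp_le_exp_of_abs_le (hK.eigenWeight_nonneg hmem.1)
    ((hK.sum_eigenWeight _).trans hmem.2) hc
  rw [← hK.trace_mul_cfc, ← hK.trace_mul_eq_sum_eigenWeight] at hHoeff
  have h : (cfc Real.exp (H + K)).trace ≤
      (cfc Real.exp H).trace * Real.exp ((gibbs H * K).trace + c ^ 2 / 2) := by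
    refine hGT.trans ?_
    conv_lhs => rw [hg, smul_mul_assoc, Matrix.trace_smul, smul_eq_mul]
    gcongr
  have := Real.log_le_log (hH.add hK).trace_cfc_exp_pos h
  rw [Real.log_mul hZ.ne' (Real.exp_pos _).ne', Real.log_exp] at this
  rw [logPartition, logPartition]
  linarith

theorem abs_eigenvalues_le_specNorm {K : Matrix (Fin n) (Fin n) ℝ} (hK : K.IsHermitian)
    (j : Fin n) : |hK.eigenvalues j| ≤ specNorm K := by
  have h := (Matrix.toEuclideanCLM (n := Fin n) (𝕜 := ℝ) K).le_opNorm (hK.eigenvectorBasis j)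
  have he : Matrix.toEuclideanCLM (n := Fin n) (𝕜 := ℝ) K (hK.eigenvectorBasis j) =
      hK.eigenvalues j • hK.eigenvectorBasis j := by
    ext i
    simpa using congrFun (hK.mulVec_eigenvectorBasis j) i
  rw [he, norm_smul, hK.eigenvectorBasis.orthonormal.1 j, mul_one, mul_one] at h
  exact h

end EntropicSDP

/-! ### Equivalence of norms on `ℝᵐ` -/

namespace Seminorm

variable {m : ℕ} (N : Seminorm ℝ (EuclideanSpace ℝ (Fin m)))

theorem exists_le_mul_norm : ∃ c, 0 ≤ c ∧ ∀ y, N y ≤ c * ‖y‖ := by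
  set e := EuclideanSpace.basisFun (Fin m) ℝ
  refine ⟨∑ i, N (e i), Finset.sum_nonneg fun i _ => apply_nonneg N _, fun y => ?_⟩
  calc N y = N (∑ i, y i • e i) := by
        conv_lhs => rw [← e.sum_repr y]
        rfl
    _ ≤ ∑ i, N (y i • e i) := 
        Finset.le_sum_of_subadditive N (map_zero N).le (map_add_le_add N) _ _
    _ ≤ ∑ i, N (e i) * ‖y‖ := by
        refine Finset.sum_le_sum fun i _ => ?_
        rw [map_smul_eq_mul, mul_comm]
        gcongr
        exact PiLp.norm_apply_le y i
    _ = _ := (Finset.sum_mul _ _ _).symm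

theorem continuous_euclideanSpace : Continuous N := by
  obtain ⟨c, hc, h⟩ := N.exists_le_mul_norm
  refine (LipschitzWith.of_dist_le_mul (K := ⟨c, hc⟩) fun x y => ?_).continuous
  rw [Real.dist_eq, dist_eq_norm]
  exact (abs_sub_map_le_sub N x y).trans (h _)

variable {N}

theorem exists_norm_le_mul (hN : ∀ x, N x = 0 → x = 0) : ∃ c, 0 ≤ c ∧ ∀ y, ‖y‖ ≤ c * N y := by
  rcases (Metric.sphere (0 : EuclideanSpace ℝ (Fin m)) 1).eq_empty_or_nonempty with h | h
  · refine ⟨0, le_rfl, fun y => ?_⟩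
    by_contra! hy
    rw [zero_mul] at hy
    have : ‖y‖⁻¹ • y ∈ Metric.sphere (0 : EuclideanSpace ℝ (Fin m)) 1 := by
      simp [norm_smul, inv_mul_cancel₀ hy.ne']
    rw [h] at this
    exact this
  · obtain ⟨u, hu, hmin⟩ := (isCompact_sphere _ _).exists_isMinOn h
      N.continuous_euclideanSpace.continuousOn
    have hNu : 0 < N u := (apply_nonneg N u).lt_of_ne' fun h0 => by
      rw [hN u h0] at hu
      simp at hu
    refine ⟨(N u)⁻¹, inv_nonneg.2 hNu.le, fun y => ?_⟩
    rcases eq_or_ne y 0 with rfl | hy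
    · simp
    have hy' : 0 < ‖y‖ := norm_pos_iff.2 hy
    have h1 : N u ≤ N (‖y‖⁻¹ • y) := hmin (by simp [norm_smul, inv_mul_cancel₀ hy'.ne'])
    rw [map_smul_eq_mul, norm_inv, norm_norm, ← div_eq_inv_mul, le_div_iff₀ hy'] at h1
    rwa [← div_eq_inv_mul, le_div_iff₀ hNu, mul_comm]

end Seminorm

/-! ### Convexity, smoothness and gradient of the objective -/

namespace EntropicSDP

section Objective

variable {m n : ℕ}

theorem inner_le_dualNorm_mul {N : Seminorm ℝ (EuclideanSpace ℝ (Fin m))}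
    (hN : ∀ x, N x = 0 → x = 0) (g y : EuclideanSpace ℝ (Fin m)) :
    inner ℝ g y ≤ dualNorm N g * N y := by
  rcases (apply_nonneg N y).eq_or_lt with h0 | h0
  · simp [hN y h0.symm]
  obtain ⟨c, hc, h⟩ := Seminorm.exists_norm_le_mul hN
  -- Needed because a real `sSup` defaults to `0` on unbounded sets.
  have hbdd : BddAbove ((fun y => inner ℝ g y) '' {y | N y ≤ 1}) := by
    refine ⟨‖g‖ * c, ?_⟩
    rintro _ ⟨z, hz, rfl⟩
    refine (real_inner_le_norm g z).trans ?_
    gcongr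
    exact (h z).trans (mul_le_of_le_one_right hc hz)
  have h1 : inner ℝ g ((N y)⁻¹ • y) ≤ dualNorm N g := by
    refine le_csSup hbdd ⟨_, ?_, rfl⟩
    rw [Set.mem_ofPred_eq, map_smul_eq_mul, norm_inv, Real.norm_of_nonneg h0.le,
      inv_mul_cancel₀ h0.ne']
  rwa [real_inner_smul_right, ← div_eq_inv_mul, div_le_iff₀ h0] at h1

variable (C : Matrix (Fin n) (Fin n) ℝ) (A : Fin m → Matrix (Fin n) (Fin n) ℝ)
  (b : EuclideanSpace ℝ (Fin m)) (β : ℝ)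

/-- The exponent `β (x · 𝐀 - C)` of the Gibbs state that attains the dual function at `x`. -/
noncomputable def hamiltonian (x : EuclideanSpace ℝ (Fin m)) : Matrix (Fin n) (Fin n) ℝ :=
  β • (comb A x - C)

/-- The gradient of the objective, `(Tr[A i ρ] - b i)ᵢ` for the Gibbs state `ρ`. -/
noncomputable def objectiveGrad (x : EuclideanSpace ℝ (Fin m)) : EuclideanSpace ℝ (Fin m) :=
  WithLp.toLp 2 fun i => (gibbs (hamiltonian C A β x) * A i).trace - b i

theorem trace_mul_comb (X : Matrix (Fin n) (Fin n) ℝ) (x : EuclideanSpace ℝ (Fin m)) :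
    (X * comb A x).trace = ∑ i, x i * (X * A i).trace := by
  simp [comb, Finset.mul_sum, Matrix.trace_sum]

theorem comb_sub (x y : EuclideanSpace ℝ (Fin m)) : comb A (y - x) = comb A y - comb A x := by
  simp [comb, sub_smul]

variable {C A β}

theorem isHermitian_comb (hA : ∀ i, (A i).IsSymm) (x : EuclideanSpace ℝ (Fin m)) :
    (comb A x).IsHermitian := by
  rw [Matrix.isHermitian_iff_isSymm, comb, Matrix.IsSymm, Matrix.transpose_sum]
  exact Finset.sum_congr rfl fun i _ => (hA i).smul _

theorem isHermitian_hamiltonian (hC : C.IsSymm) (hA : ∀ i, (A i).IsSymm)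
    (x : EuclideanSpace ℝ (Fin m)) : (hamiltonian C A β x).IsHermitian :=
  Matrix.isHermitian_iff_isSymm.2
    (((Matrix.isHermitian_iff_isSymm.1 (isHermitian_comb hA x)).sub hC).smul β)

theorem lagrangian_eq (hβ : β ≠ 0) (X : Matrix (Fin n) (Fin n) ℝ)
    (x : EuclideanSpace ℝ (Fin m)) :
    lagrangian C A b β X x =
      -(β⁻¹ * ((X * hamiltonian C A β x).trace - entropy X) - ∑ i, x i * b i) := by
  rw [lagrangian, hamiltonian, Matrix.mul_smul, Matrix.trace_smul, Matrix.mul_sub,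
    Matrix.trace_sub, trace_mul_comb, Matrix.trace_mul_comm C]
  simp only [Matrix.trace_mul_comm (A _) X, mul_sub, Finset.sum_sub_distrib, smul_eq_mul]
  rw [inv_mul_cancel_left₀ hβ, inv_mul_cancel_left₀ hβ]
  ring

theorem inner_objectiveGrad (x y : EuclideanSpace ℝ (Fin m)) :
    inner ℝ (objectiveGrad C A b β x) y =
      (gibbs (hamiltonian C A β x) * comb A y).trace - ∑ i, y i * b i := by
  rw [trace_mul_comb, ← Finset.sum_sub_distrib]
  simp [PiLp.inner_apply, objectiveGrad, mul_sub]

theorem hamiltonian_eq_add (x y : EuclideanSpace ℝ (Fin m)) :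
    hamiltonian C A β y = hamiltonian C A β x + β • comb A (y - x) := by
  rw [hamiltonian, hamiltonian, comb_sub, ← smul_add]
  congr 1
  abel

variable [NeZero n]

theorem objective_eq (hβ : 0 < β) (hC : C.IsSymm) (hA : ∀ i, (A i).IsSymm)
    (x : EuclideanSpace ℝ (Fin m)) :
    objective C A b β x = β⁻¹ * logPartition (hamiltonian C A β x) - ∑ i, x i * b i := by
  have hH := isHermitian_hamiltonian (β := β) hC hA x
  have hleast : IsLeast ((fun X => lagrangian C A b β X x) '' densityMatrices n)
      (-(β⁻¹ * logPartition (hamiltonian C A β x) - ∑ i, x i * b i)) := by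
    refine ⟨⟨_, gibbs_mem hH, ?_⟩, ?_⟩
    · simp only [lagrangian_eq b hβ.ne', trace_gibbs_mul_sub_entropy hH]
    · rintro _ ⟨X, hX, rfl⟩
      simp only [lagrangian_eq b hβ.ne']
      gcongr
      exact trace_mul_sub_entropy_le hH hX
  rw [objective, dualFun, hleast.csInf_eq, neg_neg]

theorem objective_add_inner_le (hβ : 0 < β) (hC : C.IsSymm) (hA : ∀ i, (A i).IsSymm)
    (x y : EuclideanSpace ℝ (Fin m)) :
    objective C A b β x + inner ℝ (objectiveGrad C A b β x) (y - x) ≤ objective C A b β y := by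
  have hx := isHermitian_hamiltonian (β := β) hC hA x
  have h := trace_mul_sub_entropy_le (isHermitian_hamiltonian (β := β) hC hA y) (gibbs_mem hx)
  have h' := trace_gibbs_mul_sub_entropy hx
  rw [hamiltonian_eq_add x y, Matrix.mul_add, Matrix.trace_add, Matrix.mul_smul,
    Matrix.trace_smul, smul_eq_mul, ← hamiltonian_eq_add x y] at h
  have h2 := mul_le_mul_of_nonneg_left h (inv_nonneg.2 hβ.le)
  have hsum : ∑ i, (y - x) i * b i = ∑ i, y i * b i - ∑ i, x i * b i := by simp [sub_mul]
  rw [← sub_nonneg] at h2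
  rw [objective_eq b hβ hC hA, objective_eq b hβ hC hA, inner_objectiveGrad, ← h', ← sub_nonneg, hsum]
  refine h2.trans_eq ?_
  field_simp
  ring

theorem objective_le_add_inner (hβ : 0 < β) (hC : C.IsSymm) (hA : ∀ i, (A i).IsSymm)
    {N : Seminorm ℝ (EuclideanSpace ℝ (Fin m))} (hNA : ∀ x, specNorm (comb A x) ≤ N x)
    (x y : EuclideanSpace ℝ (Fin m)) :
    objective C A b β y ≤
      objective C A b β x + inner ℝ (objectiveGrad C A b β x) (y - x) + β / 2 * N (y - x) ^ 2 := by
  have hx := isHermitian_hamiltonian (β := β) hC hA x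
  have hK : (β • comb A (y - x)).IsHermitian := Matrix.isHermitian_iff_isSymm.2
    ((Matrix.isHermitian_iff_isSymm.1 (isHermitian_comb hA (y - x))).smul β)
  have hc : ∀ j, |hK.eigenvalues j| ≤ β * N (y - x) := fun j => by
    refine (abs_eigenvalues_le_specNorm hK j).trans ?_
    rw [specNorm, map_smul, norm_smul, Real.norm_of_nonneg hβ.le]
    gcongr
    exact hNA _
  have h := logPartition_add_le hx hK hc
  rw [← hamiltonian_eq_add x y, Matrix.mul_smul, Matrix.trace_smul, smul_eq_mul] at h
  have h2 := mul_le_mul_of_nonneg_left h (inv_nonneg.2 hβ.le)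
  have hsum : ∑ i, (y - x) i * b i = ∑ i, y i * b i - ∑ i, x i * b i := by simp [sub_mul]
  rw [← sub_nonneg] at h2
  rw [objective_eq b hβ hC hA, objective_eq b hβ hC hA, inner_objectiveGrad, ← sub_nonneg, hsum]
  refine h2.trans_eq ?_
  field_simp
  ring

/-- Convexity and smoothness squeeze the first-order remainder between `0` and a multiple of `‖y -
x‖ ^ 2`. -/
theorem hasGradientAt_objective (hβ : 0 < β) (hC : C.IsSymm) (hA : ∀ i, (A i).IsSymm)
    {N : Seminorm ℝ (EuclideanSpace ℝ (Fin m))} (hNA : ∀ x, specNorm (comb A x) ≤ N x)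
    (x : EuclideanSpace ℝ (Fin m)) :
    HasGradientAt (objective C A b β) (objectiveGrad C A b β x) x := by
  obtain ⟨c, hc, hNc⟩ := N.exists_le_mul_norm
  rw [hasGradientAt_iff_isLittleO]
  have hO : (fun y => objective C A b β y - objective C A b β x -
      inner ℝ (objectiveGrad C A b β x) (y - x)) =O[𝓝 x] fun y => ‖y - x‖ ^ 2 := by
    refine Asymptotics.IsBigO.of_bound (β / 2 * c ^ 2) (Eventually.of_forall fun y => ?_)
    have h1 := objective_add_inner_le b hβ hC hA x y
    have h2 := objective_le_add_inner b hβ hC hA hNA x y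
    have h3 : β / 2 * N (y - x) ^ 2 ≤ β / 2 * (c * ‖y - x‖) ^ 2 := by
      gcongr
      exact hNc _
    rw [Real.norm_of_nonneg (by linarith), Real.norm_of_nonneg (by positivity)]
    linarith
  exact hO.trans_isLittleO <|
    (Asymptotics.isLittleO_norm_pow_id one_lt_two).comp_tendsto (tendsto_sub_nhds_zero_iff.2 tendsto_id)

end Objective

/-! ### Inexact steepest descent -/

section Descent

variable {m : ℕ} {N : Seminorm ℝ (EuclideanSpace ℝ (Fin m))}
  {f : EuclideanSpace ℝ (Fin m) → ℝ} {v g x x' z : EuclideanSpace ℝ (Fin m)} {β η γ α D : ℝ}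

/-- The progress of one inexact steepest descent step, measured against the point
`x + α (z - x)`. -/
theorem IsDescentStep.sub_le (hstep : IsDescentStep N f η g x x') (hβη : β < η⁻¹) (hη : 0 < η)
    (hγ : 0 ≤ γ) (hα : 0 ≤ α)
    (hlower : f x + inner ℝ v (z - x) ≤ f z)
    (hupper : f x' ≤ f x + inner ℝ v (x' - x) + β / 2 * N (x' - x) ^ 2)
    (herr : ∀ y, inner ℝ (g - v) y ≤ γ * N y) (hD : N (x - z) ^ 2 ≤ D) :
    f x' - f z ≤ (1 - α) * (f x - f z) +
      (γ * α * √D + α ^ 2 * D * η⁻¹ / 2 + γ ^ 2 / (2 * (η⁻¹ - β))) := by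
  have hmin := hstep (Set.mem_univ (x + α • (z - x)))
  simp only [Set.mem_ofPred_eq, add_sub_cancel_left, real_inner_smul_right, map_smul_eq_mul,
    Real.norm_of_nonneg hα] at hmin
  have e1 := herr (-(x' - x))
  have e2 := mul_le_mul_of_nonneg_left (herr (z - x)) hα
  have e3 := mul_le_mul_of_nonneg_left hlower hα
  rw [inner_neg_right, map_neg_eq_map, inner_sub_left] at e1
  rw [inner_sub_left] at e2
  rw [map_sub_rev] at hD
  have hr : N (z - x) ≤ √D := Real.le_sqrt_of_sq_le hD
  set r := N (z - x)
  set d := N (x' - x)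
  have hM : 1 / (2 * η) = η⁻¹ / 2 := by field_simp
  rw [hM] at hmin
  have hη' : 0 < η⁻¹ := inv_pos.2 hη
  set M := η⁻¹
  -- Young's inequality: the gap between `η⁻¹` and `β` pays for the gradient error along the step.
  have e4 : γ * d - (M - β) / 2 * d ^ 2 ≤ γ ^ 2 / (2 * (M - β)) := by
    have hpos : 0 < M - β := sub_pos.2 hβη
    rw [le_div_iff₀ (by positivity)]
    nlinarith [sq_nonneg (γ - (M - β) * d)]
  have e5 : γ * α * r ≤ γ * α * √D := by gcongr
  have e6 : α ^ 2 * r ^ 2 * M / 2 ≤ α ^ 2 * D * M / 2 := by gcongr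
  rw [mul_pow] at hmin
  linarith

/-- With the optimal interpolation parameter, the error terms of a descent step are at most the
limiting accuracy times the parameter. -/
theorem descent_error_le {M : ℝ} (hβ : 0 < β) (hM : 2 * β ≤ M) (hD : 0 ≤ D)
    (hγ : 0 ≤ γ) (hγD : γ ≤ √(3 * β ^ 2 * D / 2))
    (hα : α = 2 * γ / √(2 * (M - β) * (2 * M - β) * D)) :
    0 ≤ α ∧ α ≤ 1 ∧ γ * α * √D + α ^ 2 * D * M / 2 + γ ^ 2 / (2 * (M - β)) ≤
      α * (γ * √(2 * (2 * M - β) * D) / √(M - β)) := by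
  have hα0 : 0 ≤ α := hα ▸ by positivity
  have h1 : 0 < M - β := by linarith
  have h2 : 0 < 2 * M - β := by linarith
  have hα1 : α ≤ 1 := by
    rw [hα]
    refine div_le_one_of_le₀ ?_ (Real.sqrt_nonneg _)
    refine Real.le_sqrt_of_sq_le ?_
    have h3 : γ ^ 2 ≤ 3 * β ^ 2 * D / 2 := by
      rw [← Real.sq_sqrt (by positivity : 0 ≤ 3 * β ^ 2 * D / 2)]
      gcongr
    -- Equality holds at `M = 2 * β`, which is where the constant in the bound on `γ` comes from.
    have h4 : β * (3 * β) ≤ (M - β) * (2 * M - β) := by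
      gcongr <;> linarith
    nlinarith [mul_le_mul_of_nonneg_right h4 hD]
  refine ⟨hα0, hα1, ?_⟩
  rcases hD.eq_or_lt with rfl | hD
  · have : γ = 0 := le_antisymm (by simpa using hγD) hγ
    simp [this]
  rw [Real.sqrt_mul (by positivity), Real.sqrt_mul (by positivity), Real.sqrt_mul zero_le_two] at hα
  rw [Real.sqrt_mul (by positivity), Real.sqrt_mul zero_le_two]
  have hP := Real.sq_sqrt h1.le
  have hQ := Real.sq_sqrt h2.le
  have hR := Real.sq_sqrt hD.le
  have hs := Real.sq_sqrt (zero_le_two (α := ℝ))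
  have hP0 := Real.sqrt_pos.2 h1
  have hQ0 := Real.sqrt_pos.2 h2
  have hR0 := Real.sqrt_pos.2 hD
  have hs0 := Real.sqrt_pos.2 (zero_lt_two (α := ℝ))
  have hMPQ : M = √(2 * M - β) ^ 2 - √(M - β) ^ 2 := by rw [hP, hQ]; ring
  rw [← hR, Real.sqrt_sq hR0.le, ← hP, Real.sqrt_sq hP0.le]
  rw [← hR, ← hP, Real.sqrt_sq hR0.le, Real.sqrt_sq hP0.le] at hα
  generalize √(M - β) = P at *
  generalize √(2 * M - β) = Q at *
  generalize √D = R at *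
  generalize √(2 : ℝ) = s at *
  have hα' : α = s * γ / (P * Q * R) := by
    rw [hα]
    field_simp
    linear_combination (-γ) * hs
  -- AM–GM `s P Q ≤ P² + Q² / 2` (with `s² = 2`), combined with `M = Q² - P²`.
  have key : s * P * Q + M + Q ^ 2 / 2 ≤ 2 * Q ^ 2 := by
    rw [hMPQ]
    nlinarith [sq_nonneg (s * P - Q)]
  have hl : γ * α * R + α ^ 2 * R ^ 2 * M / 2 + γ ^ 2 / (2 * P ^ 2) =
      γ ^ 2 / (P ^ 2 * Q ^ 2) * (s * P * Q + M + Q ^ 2 / 2) := by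
    rw [hα']
    field_simp
    linear_combination (M * γ ^ 2) * hs
  have hr : α * (γ * (s * Q * R) / P) = γ ^ 2 / (P ^ 2 * Q ^ 2) * (2 * Q ^ 2) := by
    rw [hα']
    field_simp
    linear_combination γ ^ 2 * hs
  rw [hl, hr]
  gcongr

end Descent

end EntropicSDP

/-! ### The convergence bound -/

theorem theorem3 {m n : ℕ} (hn : 0 < n)
    -- the data of the semidefinite program
    (C : Matrix (Fin n) (Fin n) ℝ) (hC : C.IsSymm)
    (A : Fin m → Matrix (Fin n) (Fin n) ℝ) (hA : ∀ i, (A i).IsSymm)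
    (b : EuclideanSpace ℝ (Fin m)) (β : ℝ) (hβ : 0 < β)
    -- a norm on `ℝᵐ` that dominates the spectral norm of `x · 𝐀`
    (N : Seminorm ℝ (EuclideanSpace ℝ (Fin m))) (hN : ∀ x, N x = 0 → x = 0)
    (hNA : ∀ x, EntropicSDP.specNorm (EntropicSDP.comb A x) ≤ N x)
    -- step size, gradient error and time horizon (finite or infinite)
    (η γ : ℝ) (hη : 0 < η) (hηβ : η ≤ 1 / (2 * β)) (hγ : 0 ≤ γ) (T : ℕ∞)
    -- the iterates and the gradient estimates
    (lam g : ℕ → EuclideanSpace ℝ (Fin m))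
    (hstep : ∀ t : ℕ, (t : ℕ∞) < T →
      EntropicSDP.IsDescentStep N (EntropicSDP.objective C A b β) η (g t) (lam t) (lam (t + 1)))
    (hgrad : ∀ t : ℕ, (t : ℕ∞) < T →
      EntropicSDP.dualNorm N (g t - gradient (EntropicSDP.objective C A b β) (lam t)) ≤ γ)
    -- a minimizer of the objective, and the finite supremum `D`
    (lamStar : EuclideanSpace ℝ (Fin m))
    (hstar : IsMinOn (EntropicSDP.objective C A b β) Set.univ lamStar)
    (D : ℝ) (hD : IsLUB {d : ℝ | ∃ t : ℕ, (t : ℕ∞) ≤ T ∧ d = N (lam t - lamStar) ^ 2} D)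
    (hγD : γ ≤ √(3 * β ^ 2 * D / 2)) :
    (∀ t : ℕ, 1 ≤ t → (t : ℕ∞) ≤ T →
      EntropicSDP.objective C A b β (lam t) - EntropicSDP.objective C A b β lamStar ≤
        (1 - 2 * γ / √(2 * (η⁻¹ - β) * (2 * η⁻¹ - β) * D)) ^ t *
            (EntropicSDP.objective C A b β (lam 0) - EntropicSDP.objective C A b β lamStar) +
          γ * √(2 * (2 * η⁻¹ - β) * D) / √(η⁻¹ - β)) ∧
    (η = 1 / (2 * β) → ∀ t : ℕ, 1 ≤ t → (t : ℕ∞) ≤ T →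
      EntropicSDP.objective C A b β (lam t) - EntropicSDP.objective C A b β lamStar ≤
        (1 - 2 * γ / √(6 * β ^ 2 * D)) ^ t *
            (EntropicSDP.objective C A b β (lam 0) - EntropicSDP.objective C A b β lamStar) +
          γ * √(6 * D)) := by
  have : NeZero n := ⟨hn.ne'⟩
  set f := EntropicSDP.objective C A b β
  have hM : 2 * β ≤ η⁻¹ := by
    rw [le_inv_comm₀ (by positivity) hη, ← one_div]
    exact hηβ
  have hD0 : 0 ≤ D := (sq_nonneg _).trans (hD.1 ⟨0, by simp, rfl⟩)
  set α := 2 * γ / √(2 * (η⁻¹ - β) * (2 * η⁻¹ - β) * D) with hα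
  obtain ⟨hα0, hα1, herror⟩ := EntropicSDP.descent_error_le hβ hM hD0 hγ hγD hα
  set ε := γ * √(2 * (2 * η⁻¹ - β) * D) / √(η⁻¹ - β) with hε
  have hε0 : 0 ≤ ε := by positivity
  -- `ε` is a fixed point of this affine recursion, so it is carried unchanged through the
  -- induction.
  have hrec : ∀ t : ℕ, (t : ℕ∞) < T →
      f (lam (t + 1)) - f lamStar ≤ (1 - α) * (f (lam t) - f lamStar) + α * ε := fun t ht => by
    have hg := hgrad t ht
    rw [(EntropicSDP.hasGradientAt_objective b hβ hC hA hNA (lam t)).gradient] at hg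
    refine ((hstep t ht).sub_le (by linarith) hη hγ hα0
      (EntropicSDP.objective_add_inner_le b hβ hC hA _ _)
      (EntropicSDP.objective_le_add_inner b hβ hC hA hNA _ _)
      (fun y => (EntropicSDP.inner_le_dualNorm_mul hN _ y).trans ?_)
      (hD.1 ⟨t, ht.le, rfl⟩)).trans (by gcongr)
    gcongr
  have hmain : ∀ t : ℕ, (t : ℕ∞) ≤ T →
      f (lam t) - f lamStar ≤ (1 - α) ^ t * (f (lam 0) - f lamStar) + ε := fun t => by
    induction t with
    | zero => intro _; simpa using hε0
    | succ t ih =>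
      intro ht
      have ht' : (t : ℕ∞) < T := lt_of_lt_of_le (by exact_mod_cast Nat.lt_succ_self t) ht
      have := mul_le_mul_of_nonneg_left (ih ht'.le) (sub_nonneg.2 hα1)
      rw [pow_succ']
      linarith [hrec t ht']
  refine ⟨fun t _ ht => hmain t ht, fun hη2 t _ ht => ?_⟩
  have hinv : η⁻¹ = 2 * β := by rw [hη2, one_div, inv_inv]
  have h1 : α = 2 * γ / √(6 * β ^ 2 * D) := by
    rw [hα, hinv]
    ring_nf
  have h2 : ε = γ * √(6 * D) := by
    rw [hε, hinv, show 2 * (2 * (2 * β) - β) * D = 6 * D * β by ring, show 2 * β - β = β by ring,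
      Real.sqrt_mul (by positivity), ← mul_assoc, mul_div_cancel_right₀ _ (by positivity)]
  rw [← h1, ← h2]
  exact hmain t ht
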